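/- **Conventions.** Manifolds are second countable Hausdorff smooth manifolds with corners (whose dimension may vary from one component to another); $\mathsf{Man}$ is the category of manifolds and smooth maps, $T:\mathsf{Man}\to\mathsf{Man}$ is the tangent functor and $\tau_M:TM\to M$ the canonical projection. A surjective submersion is a surjective smooth map whose differential at every point is surjective. A *hybrid phase space* $a$ consists of a small category $\mathbb S^a$ (its objects are called nodes, its morphisms edges), a manifold $a(s)$ for every node $s$, and a relation $a(\gamma)\subseteq a(s)\times a(s')$ for every edge $\gamma:s\to s'$, such that $a(\mathrm{id}_s)$ is the diagonal and $a(\gamma'\circ\gamma)=a(\gamma')\circ a(\gamma)$, and such that the disjoint union $\mathbb U a:=\bigsqcup_s a(s)$ is a manifold (only second countability is at issue). A *morphism* $f:a\to b$ consists of a functor $\varphi:\mathbb S^a\to\mathbb S^b$ and smooth maps $f_s:a(s)\to b(\varphi(s))$ with $(f_s\times f_{s'})(a(\gamma))\subseteq b(\varphi(\gamma))$ for every edge $\gamma:s\to s'$. This gives the category $\mathsf{HyPh}$ and the functor $\mathbb U:\mathsf{HyPh}\to\mathsf{Man}$. Finite products in $\mathsf{HyPh}$ are products of the categories of nodes, with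 product manifolds and componentwise relations. A *hybrid surjective submersion* $a$ is a morphism $p_a:a_{tot}\to a_{st}$ of $\mathsf{HyPh}$ such that $\mathbb U p_a$ is a surjective submersion; $\mathsf{HySSub}$ is the full subcategory of the arrow category of $\mathsf{HyPh}$ on these, so that a morphism $f$ is a pair $(f_{tot},f_{st})$; it has finite products, formed on total and on state spaces. A morphism $f$ is an *interconnection* if $f_{st}$ is an isomorphism. Put $$\mathsf{Crl}_{\mathbb U}(a)=\{V:\mathbb U a_{tot}\to T\mathbb U a_{st}\ \text{smooth}:\ \tau_{\mathbb U a_{st}}\circ V=\mathbb U p_a\}.$$ For $f:a\to b$, controls $V\in\mathsf{Crl}_{\mathbb U}(a)$ and $W\in\mathsf{Crl}_{\mathbb U}(b)$ are *$f$-related* if $T\mathbb U f_{st}\circ V=W\circ\mathbb U f_{tot}$; let $\mathsf{Crl}_{\mathbb U}(f)\subseteq\mathsf{Crl}_{\mathbb U}(a)\times\mathsf{Crl}_{\mathbb U}(b)$ denote this relation. If $i:a\to b$ is an interconnection, let $i^*:\mathsf{Crl}_{\mathbb U}(b)\to\mathsf{Crl}_{\mathbb U}(a)$ be the map $i^*W=T\mathbb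 U(i_{st}^{-1})\circ W\circ\mathbb U i_{tot}$. For a finite family $(H_x)_{x\in X}$ in $\mathsf{HySSub}$ let $\mathscr P_X:\prod_x\mathsf{Crl}_{\mathbb U}(H_x)\to\mathsf{Crl}_{\mathbb U}(\prod_x H_x)$ be the map that sends $(v_x)_x$ to $\prod_x v_x$, under the canonical identifications $\mathbb U\prod_x (H_x)_{tot}\cong\prod_x\mathbb U (H_x)_{tot}$ and $\prod_xT\mathbb U(H_x)_{st}\cong T\mathbb U\prod_x(H_x)_{st}$. A *network of hybrid open systems* is a finite family $(H_{X,x})_{x\in X}$ in $\mathsf{HySSub}$ with an interconnection $i_{a,X}:a\to\prod_{x}H_{X,x}$. A *morphism* $((\varphi,\Phi),z)$ from $((H_{X,x})_{x\in X},i_{a,X}:a\to\prod_x H_{X,x})$ to $((H_{Y,y})_{y\in Y},i_{b,Y}:b\to\prod_y H_{Y,y})$ consists of a map $\varphi:X\to Y$, morphisms $\Phi_x:H_{Y,\varphi(x)}\to H_{X,x}$ of $\mathsf{HySSub}$ for $x\in X$, and a morphism $z:b\to a$ of $\mathsf{HySSub}$, such that $i_{a,X}\circ z=\Pi(\varphi,\Phi)\circ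 i_{b,Y}$, where $\Pi(\varphi,\Phi):\prod_yH_{Y,y}\to\prod_xH_{X,x}$ is the morphism with $\mathrm{pr}_x\circ\Pi(\varphi,\Phi)=\Phi_x\circ\mathrm{pr}_{\varphi(x)}$ for all $x$. **Theorem.** Let $((\varphi,\Phi),z)$ be a morphism of networks of hybrid open systems as above, and let $$\mathsf{Crl}_{\mathbb U}(\varphi,\Phi)=\Big\{\big((w_y)_y,(v_x)_x\big)\in\prod_{y\in Y}\mathsf{Crl}_{\mathbb U}(H_{Y,y})\times\prod_{x\in X}\mathsf{Crl}_{\mathbb U}(H_{X,x}):\ (w_{\varphi(x)},v_x)\text{ are }\Phi_x\text{-related for every }x\in X\Big\}.$$ Then there is a 1-morphism from $\mathsf{Crl}_{\mathbb U}(\varphi,\Phi)$ to $\mathsf{Crl}_{\mathbb U}(z)$ over the functions $i_{b,Y}^*\circ\mathscr P_Y$ and $i_{a,X}^*\circ\mathscr P_X$ in the double category $\mathsf{Set}^\square$ of sets, functions, relations and inclusions; that is, $$\big((i_{b,Y}^*\circ\mathscr P_Y)\times(i_{a,X}^*\circ\mathscr P_X)\big)\big(\mathsf{Crl}_{\mathbb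 U}(\varphi,\Phi)\big)\subseteq\mathsf{Crl}_{\mathbb U}(z).$$ Consequently, if $(w_{\varphi(x)},v_x)$ are $\Phi_x$-related for all $x\in X$, then the controls $i_{b,Y}^*\mathscr P_Y((w_y)_y)$ on $b$ and $i_{a,X}^*\mathscr P_X((v_x)_x)$ on $a$ are $z$-related. -/

import Mathlib

open Set Filter Topology CategoryTheory
open scoped Manifold ContDiff

universe u

namespace Hybrid

section Pi
variable {X : Type u} [Fintype X] {E H M : X → Type u} [∀ x, NormedAddCommGroup (E x)]
  [∀ x, NormedSpace ℝ (E x)] [∀ x, TopologicalSpace (H x)] [∀ x, TopologicalSpace (M x)]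
  [∀ x, ChartedSpace (H x) (M x)] (I : ∀ x, ModelWithCorners ℝ (E x) (H x))

theorem range_modelPi : range (ModelWithCorners.pi I) = Set.pi univ (fun x => range (I x)) := by
  change range (fun (f : ModelPi H) x => I x (f x)) = _
  ext e
  constructor
  · rintro ⟨f, rfl⟩ x _
    exact ⟨f x, rfl⟩
  · intro h
    choose f hf using fun x => h x trivial
    exact ⟨f, funext hf⟩

theorem isManifold_pi [∀ x, IsManifold (I x) ∞ (M x)] :
    IsManifold (ModelWithCorners.pi I) ∞ (∀ x, M x) := by
  apply isManifold_of_contDiffOn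
  rintro _ _ ⟨e, he, rfl⟩ ⟨e', he', rfl⟩
  rw [contDiffOn_pi]
  intro x
  have hc : (e x).symm ≫ₕ e' x ∈ contDiffGroupoid ∞ (I x) :=
    HasGroupoid.compatible (he x trivial) (he' x trivial)
  rw [contDiffGroupoid, mem_groupoid_of_pregroupoid] at hc
  have h1 : ContDiffOn ℝ ∞ (I x ∘ ((e x).symm ≫ₕ e' x) ∘ (I x).symm)
      ((I x).symm ⁻¹' ((e x).symm ≫ₕ e' x).source ∩ range (I x)) := hc.1
  have h2 := h1.comp (s := (ModelWithCorners.pi I).symm ⁻¹'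
      ((OpenPartialHomeomorph.pi e).symm ≫ₕ OpenPartialHomeomorph.pi e').source ∩
      range (ModelWithCorners.pi I))
    ((ContinuousLinearMap.proj x : (∀ x, E x) →L[ℝ] E x).contDiff.contDiffOn) (by
      rintro v ⟨hv, hv'⟩
      rw [range_modelPi] at hv'
      refine ⟨?_, hv' x trivial⟩
      have h3 := hv.1 x trivial
      have h4 := hv.2 x trivial
      exact ⟨h3, h4⟩)
  exact h2

theorem contMDiffAt_pi_iff {E' H' N : Type u} [NormedAddCommGroup E'] [NormedSpace ℝ E']
    [TopologicalSpace H'] [TopologicalSpace N] [ChartedSpace H' N] (J : ModelWithCorners ℝ E' H')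
    {f : N → ∀ x, M x} {p : N} :
    ContMDiffAt J (ModelWithCorners.pi I) ∞ f p ↔ ∀ x, ContMDiffAt J (I x) ∞ (fun y => f y x) p := by
  have h (x : X) := contMDiffAt_iff_target (I := J) (I' := I x) (n := ∞) (f := fun y => f y x) (x := p)
  rw [contMDiffAt_iff_target, forall_congr' h, forall_and, ← continuousAt_pi]
  refine and_congr_right fun _ => ?_
  exact contMDiffAt_pi_space

theorem contMDiff_eval (x : X) :
    ContMDiff (ModelWithCorners.pi I) (I x) ∞ (fun f : ∀ x, M x => f x) := fun p =>
  (contMDiffAt_pi_iff I (ModelWithCorners.pi I) (f := id) (p := p)).1 contMDiffAt_id x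

theorem hasMFDerivAt_eval (x : X) (p : ∀ x, M x) :
    HasMFDerivAt (ModelWithCorners.pi I) (I x) (fun f : ∀ x, M x => f x) p
      (ContinuousLinearMap.proj x : (∀ x, E x) →L[ℝ] E x) := by
  refine ⟨(continuous_apply x).continuousAt, ?_⟩
  have : ∀ᶠ y in 𝓝[range (ModelWithCorners.pi I)] extChartAt (ModelWithCorners.pi I) p p,
      (extChartAt (I x) (p x) ∘ (fun f : ∀ x, M x => f x) ∘
        (extChartAt (ModelWithCorners.pi I) p).symm) y = y x := by
    filter_upwards [extChartAt_target_mem_nhdsWithin (I := ModelWithCorners.pi I) p] with y hy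
    refine (extChartAt (I x) (p x)).right_inv ?_
    rw [extChartAt_target, range_modelPi] at hy
    rw [extChartAt_target]
    exact ⟨hy.1 x trivial, hy.2 x trivial⟩
  refine HasFDerivWithinAt.congr_of_eventuallyEq
    ((ContinuousLinearMap.proj x : (∀ x, E x) →L[ℝ] E x).hasFDerivWithinAt) this ?_
  exact (extChartAt (I x) (p x)).right_inv <|
    (extChartAt (I x) (p x)).map_source (mem_extChartAt_source _)

attribute [local instance] isManifold_pi

theorem tangentCoordChange_pi [∀ x, IsManifold (I x) ∞ (M x)] (p q z : ∀ x, M x)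
    (hp : ∀ x, z x ∈ (chartAt (H x) (p x)).source) (hq : ∀ x, z x ∈ (chartAt (H x) (q x)).source)
    (v : ∀ x, E x) (x : X) :
    tangentCoordChange (ModelWithCorners.pi I) p q z v x =
      tangentCoordChange (I x) (p x) (q x) (z x) (v x) := by
  have h1 : HasFDerivWithinAt ((extChartAt (ModelWithCorners.pi I) q) ∘
      (extChartAt (ModelWithCorners.pi I) p).symm)
      (ContinuousLinearMap.pi fun x => (tangentCoordChange (I x) (p x) (q x) (z x)).comp
        (ContinuousLinearMap.proj x : (∀ x, E x) →L[ℝ] E x))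
      (range (ModelWithCorners.pi I)) (extChartAt (ModelWithCorners.pi I) p z) := by
    rw [hasFDerivWithinAt_pi]
    intro x
    have h2 := hasFDerivWithinAt_tangentCoordChange (I := I x) (x := p x) (y := q x) (z := z x)
      ⟨by rw [extChartAt_source]; exact hp x, by rw [extChartAt_source]; exact hq x⟩
    refine HasFDerivWithinAt.comp (t := range (I x)) (extChartAt (ModelWithCorners.pi I) p z) h2
      ((ContinuousLinearMap.proj x : (∀ x, E x) →L[ℝ] E x).hasFDerivWithinAt) ?_
    intro w hw
    rw [range_modelPi] at hw
    exact hw x trivial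
  have h3 := hasFDerivWithinAt_tangentCoordChange (I := ModelWithCorners.pi I)
    (x := p) (y := q) (z := z)
      ⟨by rw [extChartAt_source]; exact fun x _ => hp x,
        by rw [extChartAt_source]; exact fun x _ => hq x⟩
  have h4 : UniqueDiffWithinAt ℝ (range (ModelWithCorners.pi I))
      (extChartAt (ModelWithCorners.pi I) p z) :=
    (ModelWithCorners.pi I).uniqueDiffOn _ (mem_range_self _)
  have h5 := h4.eq h3 h1
  rw [h5]
  rfl

theorem contMDiff_tangentPi [∀ x, IsManifold (I x) ∞ (M x)] :
    ContMDiff (ModelWithCorners.pi fun x => (I x).tangent) (ModelWithCorners.pi I).tangent ∞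
      (fun v : ∀ x, TangentBundle (I x) (M x) =>
        (⟨fun x => (v x).proj, fun x => (v x).2⟩ :
          TangentBundle (ModelWithCorners.pi I) (∀ x, M x))) := by
  intro v₀
  rw [Bundle.contMDiffAt_totalSpace]
  have hev (x : X) := contMDiff_eval (M := fun x => TangentBundle (I x) (M x))
    (fun x => (I x).tangent) x
  constructor
  · rw [contMDiffAt_pi_iff]
    intro x
    exact ((Bundle.contMDiff_proj (TangentSpace (I x) : M x → Type _)).comp (hev x)) v₀
  · rw [contMDiffAt_pi_space]
    intro x
    have h1 := ((Bundle.contMDiffAt_totalSpace (F := E x) (E := (TangentSpace (I x) : M x → Type _))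
      (IB := I x)).1 (hev x v₀)).2
    refine h1.congr_of_eventuallyEq ?_
    have h2 : ∀ᶠ v in 𝓝 v₀, ∀ y : X, (v y).proj ∈ (chartAt (H y) (v₀ y).proj).source := by
      rw [eventually_all]
      intro y
      have hc : Continuous fun v : ∀ x, TangentBundle (I x) (M x) => (v y).proj :=
        (FiberBundle.continuous_proj (E y) (TangentSpace (I y) : M y → Type _)).comp
          (continuous_apply y)
      exact hc.continuousAt.eventually
        ((chartAt (H y) (v₀ y).proj).open_source.mem_nhds (mem_chart_source _ _))
    filter_upwards [h2] with v hv
    exact tangentCoordChange_pi I (fun x => (v x).proj) (fun x => (v₀ x).proj)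
      (fun x => (v x).proj) (fun x => mem_chart_source _ _) hv (fun x => (v x).2) x

theorem tangentMap_eval [∀ x, IsManifold (I x) ∞ (M x)] (x : X)
    (v : TangentBundle (ModelWithCorners.pi I) (∀ x, M x)) :
    tangentMap (ModelWithCorners.pi I) (I x) (fun f : ∀ x, M x => f x) v =
      ⟨v.proj x, (show ∀ x, E x from v.2) x⟩ := by
  simp only [tangentMap]
  rw [(hasMFDerivAt_eval I x v.proj).mfderiv]
  rfl

end Pi

section Orthant
/-- The range of the model is, in suitable linear coordinates, `[0,∞)^S × ℝ^(κ \ S)`. -/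
class IsOrthant {E H : Type u} [NormedAddCommGroup E] [NormedSpace ℝ E] [TopologicalSpace H]
    (I : ModelWithCorners ℝ E H) : Prop where
  exists_coord : ∃ (κ : Type u) (_ : Fintype κ) (S : Set κ) (L : E ≃L[ℝ] (κ → ℝ)),
    range I = {e | ∀ k ∈ S, 0 ≤ L e k}

theorem IsOrthant.finiteDimensional {E H : Type u} [NormedAddCommGroup E] [NormedSpace ℝ E] [TopologicalSpace H]
    (I : ModelWithCorners ℝ E H) [h : IsOrthant I] : FiniteDimensional ℝ E := by
  obtain ⟨κ, _, S, L, _⟩ := h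
  exact L.symm.toLinearEquiv.finiteDimensional

theorem IsOrthant.tangent {E H : Type u} [NormedAddCommGroup E] [NormedSpace ℝ E] [TopologicalSpace H]
    (I : ModelWithCorners ℝ E H) [h : IsOrthant I] : IsOrthant I.tangent := by
  obtain ⟨κ, _, S, L, hL⟩ := h
  refine ⟨κ ⊕ κ, inferInstance, Sum.inl '' S,
    (L.prodCongr L).trans (ContinuousLinearEquiv.sumPiEquivProdPi ℝ κ κ fun _ => ℝ).symm, ?_⟩
  ext ⟨a, b⟩
  have : range I.tangent = range I ×ˢ univ := by
    rw [ModelWithCorners.tangent, modelWithCorners_prod_coe, range_prodMap]; simp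
  rw [this, hL]
  constructor
  · rintro ⟨h, -⟩ _ ⟨k, hk, rfl⟩
    exact h k hk
  · intro h
    exact ⟨fun k hk => h _ ⟨k, hk, rfl⟩, trivial⟩

theorem IsOrthant.pi {X : Type u} [Fintype X] {E H : X → Type u} [∀ x, NormedAddCommGroup (E x)]
  [∀ x, NormedSpace ℝ (E x)] [∀ x, TopologicalSpace (H x)] 
  (I : ∀ x, ModelWithCorners ℝ (E x) (H x))  [h : ∀ x, IsOrthant (I x)] : IsOrthant (ModelWithCorners.pi I) := by
  choose κ hκ S L hL using fun x => (h x).exists_coord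
  refine ⟨Σ x, κ x, inferInstance, {k | k.2 ∈ S k.1}, 
   (ContinuousLinearEquiv.piCongrRight L).trans (LinearEquiv.piCurry ℝ (fun _ _ => ℝ)).symm.toContinuousLinearEquiv, ?_⟩
  rw [range_modelPi]
  ext e
  constructor
  · rintro h ⟨x, k⟩ hk
    have := h x trivial
    change e x ∈ range (I x) at this
    rw [hL x] at this
    exact this k hk
  · intro h x _
    change e x ∈ range (I x)
    rw [hL x]
    intro k hk
    exact h ⟨x, k⟩ hk
end Orthant

section TB
variable {E H M : Type u} [NormedAddCommGroup E] [NormedSpace ℝ E] [TopologicalSpace H]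
  [TopologicalSpace M] [ChartedSpace H M] (I : ModelWithCorners ℝ E H) [IsManifold I ∞ M]

theorem t2_tangent [T2Space M] : T2Space (TangentBundle I M) := by
  have hc : Continuous fun v : TangentBundle I M => v.proj :=
    FiberBundle.continuous_proj E (TangentSpace I : M → Type _)
  refine ⟨fun v w hvw => ?_⟩
  by_cases h : v.proj = w.proj
  · let e := trivializationAt E (TangentSpace I : M → Type _) v.proj
    have hv : v ∈ e.source := by simp [e]
    have hw : w ∈ e.source := by simp [e, h]
    have hne : e v ≠ e w := fun h' => hvw (e.injOn hv hw h')
    have hsnd : (e v).2 ≠ (e w).2 := fun h' => hne (Prod.ext (by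
      rw [e.coe_fst hv, e.coe_fst hw, h]) h')
    obtain ⟨U, V, hU, hV, hvU, hwV, hd⟩ := t2_separation hsnd
    refine ⟨e.source ∩ e ⁻¹' (univ ×ˢ U), e.source ∩ e ⁻¹' (univ ×ˢ V), 
      e.continuousOn.isOpen_inter_preimage e.open_source (isOpen_univ.prod hU),
      e.continuousOn.isOpen_inter_preimage e.open_source (isOpen_univ.prod hV),
      ⟨hv, trivial, hvU⟩, ⟨hw, trivial, hwV⟩, ?_⟩
    rw [Set.disjoint_left]
    rintro z ⟨_, _, hz⟩ ⟨_, _, hz'⟩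
    exact Set.disjoint_left.1 hd hz hz'
  · obtain ⟨U, V, hU, hV, hvU, hwV, hd⟩ := t2_separation h
    exact ⟨_, _, hU.preimage hc, hV.preimage hc, hvU, hwV, hd.preimage _⟩

theorem secondCountable_tangent [IsOrthant I] [SecondCountableTopology M] :
    SecondCountableTopology (TangentBundle I M) := by
  have := IsOrthant.finiteDimensional I
  have := I.secondCountableTopology
  have : SecondCountableTopology (ModelProd H E) := inferInstanceAs (SecondCountableTopology (H × E))
  obtain ⟨s, hs, hs'⟩ := TopologicalSpace.countable_cover_nhds
    (fun x : M => (chartAt H x).open_source.mem_nhds (mem_chart_source H x))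
  refine ChartedSpace.secondCountable_of_countable_cover (ModelProd H E)
    (s := (fun x : M => (⟨x, 0⟩ : TangentBundle I M)) '' s) ?_ (hs.image _)
  rw [biUnion_image]
  ext v
  have := hs'.ge (mem_univ v.proj)
  simp only [mem_iUnion] at this ⊢
  obtain ⟨x, hx, h⟩ := this
  simpa using ⟨x, hx, h⟩

end TB
noncomputable section

/-- A smooth manifold with corners of constant dimension: Hausdorff, second countable, with an
atlas of charts in an orthant of a finite-dimensional real vector space. -/
structure CornerMfd : Type (u + 1) where
  E : Type u
  H : Type u
  carrier : Type u
  [normE : NormedAddCommGroup E]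
  [spaceE : NormedSpace ℝ E]
  [topH : TopologicalSpace H]
  [top : TopologicalSpace carrier]
  [charted : ChartedSpace H carrier]
  I : ModelWithCorners ℝ E H
  [orthant : IsOrthant I]
  [smooth : IsManifold I ∞ carrier]
  [t2 : T2Space carrier]
  [secondCountable : SecondCountableTopology carrier]

namespace CornerMfd
instance : CoeSort CornerMfd.{u} (Type u) := ⟨CornerMfd.carrier⟩

attribute [instance] normE spaceE topH top charted orthant smooth t2 secondCountable

/-- The total space of the tangent bundle. -/
def tangent (A : CornerMfd.{u}) : CornerMfd.{u} where
  E := A.E × A.E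
  H := ModelProd A.H A.E
  carrier := TangentBundle A.I A
  I := A.I.tangent
  orthant := IsOrthant.tangent A.I
  t2 := t2_tangent A.I
  secondCountable := secondCountable_tangent A.I

theorem contMDiff_proj (A : CornerMfd.{u}) :
    ContMDiff A.I.tangent A.I ∞ (fun v : TangentBundle A.I A => v.proj) :=
  Bundle.contMDiff_proj (TangentSpace A.I : A → Type _)

/-- The product of a finite family. -/
def pi {X : Type u} [Fintype X] (A : X → CornerMfd.{u}) : CornerMfd.{u} where
  E := ∀ x, (A x).E
  H := ModelPi fun x => (A x).H
  carrier := ∀ x, A x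
  I := ModelWithCorners.pi fun x => (A x).I
  orthant := IsOrthant.pi _
  smooth := isManifold_pi _

end CornerMfd

/-- A manifold with corners, whose dimension may differ from one connected component to another:
the disjoint union of a countable family of manifolds with corners of constant dimension. -/
structure Man : Type (u + 1) where
  ι : Type u
  [countable : Countable ι]
  piece : ι → CornerMfd.{u}

namespace Man
attribute [instance] countable

/-- The points of a manifold: the disjoint union of the pieces. -/
instance : CoeSort Man.{u} (Type u) := ⟨fun M => Σ i, M.piece i⟩

/-- Near the point `x` of the `i`-th piece, `f` is given by the map `g` into the `j`-th piece, and
`g` is smooth there. -/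
def IsLocalRep {M N : Man.{u}} (f : M → N) (i : M.ι) (x : M.piece i) (j : N.ι)
    (g : M.piece i → N.piece j) : Prop :=
  ∀ᶠ y in 𝓝 x, ContMDiffAt (M.piece i).I (N.piece j).I ∞ g y ∧ f ⟨i, y⟩ = ⟨j, g y⟩

/-- Smooth maps: near every point the map is given by a smooth map from the piece of the point to
a piece of the target. -/
@[ext]
structure Hom (M N : Man.{u}) : Type u where
  toFun : M → N
  smooth : ∀ (i : M.ι) (x : M.piece i), ∃ j g, IsLocalRep toFun i x j g

theorem IsLocalRep.smoothAt {M N : Man.{u}} {f : M → N} {i x j g} (h : IsLocalRep f i x j g) :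
    ContMDiffAt (M.piece i).I (N.piece j).I ∞ g x := h.self_of_nhds.1

theorem IsLocalRep.eq {M N : Man.{u}} {f : M → N} {i x j g} (h : IsLocalRep f i x j g) :
    f ⟨i, x⟩ = ⟨j, g x⟩ := h.self_of_nhds.2

theorem IsLocalRep.of_contMDiff {M N : Man.{u}} {f : M → N} {i : M.ι} {j : N.ι}
    {g : M.piece i → N.piece j} (hg : ContMDiff (M.piece i).I (N.piece j).I ∞ g)
    (h : ∀ y, f ⟨i, y⟩ = ⟨j, g y⟩) (x : M.piece i) : IsLocalRep f i x j g :=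
  Eventually.of_forall fun y => ⟨hg y, h y⟩

theorem IsLocalRep.comp {M N P : Man.{u}} {f : M → N} {f' : N → P} {i x j g k g'}
    (h' : IsLocalRep f' j (g x) k g') (h : IsLocalRep f i x j g) :
    IsLocalRep (fun p => f' (f p)) i x k (fun y => g' (g y)) := by
  filter_upwards [h, h.smoothAt.continuousAt.eventually h'] with y hy hy'
  exact ⟨hy'.1.comp y hy.1, by rw [hy.2, hy'.2]⟩

/-- The category of manifolds with corners and smooth maps. -/
instance : Category Man.{u} where
  Hom := Hom
  id M := ⟨fun p => p, fun i x => ⟨i, fun y => y, .of_contMDiff contMDiff_id (fun _ => rfl) x⟩⟩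
  comp f g := ⟨fun p => g.toFun (f.toFun p), fun i x => by
    obtain ⟨j, r, h⟩ := f.smooth i x
    obtain ⟨k, r', h'⟩ := g.smooth j (r x)
    exact ⟨k, _, h'.comp h⟩⟩

instance {M N : Man.{u}} : CoeFun (M ⟶ N) (fun _ => M → N) := ⟨Hom.toFun⟩

@[ext] theorem hom_ext {M N : Man.{u}} {f g : M ⟶ N} (h : ∀ p, f p = g p) : f = g :=
  Hom.ext (funext h)

@[simp] theorem id_apply (M : Man.{u}) (p : M) : (𝟙 M : M ⟶ M) p = p := rfl
@[simp] theorem comp_apply {M N P : Man.{u}} (f : M ⟶ N) (g : N ⟶ P) (p : M) :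
    (f ≫ g) p = g (f p) := rfl

/-- The total space of the tangent bundle. -/
def tangent (M : Man.{u}) : Man.{u} where
  ι := M.ι
  piece i := (M.piece i).tangent

/-- The tangent vector `v` at the point `x` of the `i`-th piece. -/
def vec {M : Man.{u}} (i : M.ι) (x : M.piece i) (v : TangentSpace (M.piece i).I x) : M.tangent :=
  ⟨i, (⟨x, v⟩ : TangentBundle (M.piece i).I (M.piece i))⟩

/-- The differential of a smooth map, on a vector at `x` the differential at `x` of any smooth map
of pieces which represents `f` near `x`. -/
def tangentFun {M N : Man.{u}} (f : M ⟶ N) (v : M.tangent) : N.tangent :=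
  ⟨(f.smooth v.1 (Bundle.TotalSpace.proj v.2)).choose,
    tangentMap (M.piece v.1).I (N.piece _).I
      (f.smooth v.1 (Bundle.TotalSpace.proj v.2)).choose_spec.choose v.2⟩

theorem tangentFun_eq {M N : Man.{u}} (f : M ⟶ N) {i x j g} (h : IsLocalRep f.toFun i x j g)
    (v : TangentSpace (M.piece i).I x) :
    tangentFun f (vec i x v) = ⟨j, tangentMap (M.piece i).I (N.piece j).I g ⟨x, v⟩⟩ := by
  have h' := (f.smooth i x).choose_spec.choose_spec
  unfold tangentFun vec
  dsimp only
  generalize (f.smooth i x).choose_spec.choose = g' at *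
  generalize (f.smooth i x).choose = j' at *
  have hj : j' = j := congrArg Sigma.fst (h'.eq.symm.trans h.eq)
  subst hj
  have hg : g' =ᶠ[𝓝 x] g := by
    filter_upwards [h, h'] with y hy hy'
    exact eq_of_heq (Sigma.mk.inj (hy'.2.symm.trans hy.2)).2
  congr 1
  simp only [tangentMap]
  rw [hg.mfderiv_eq, hg.self_of_nhds]

theorem IsLocalRep.tangent {M N : Man.{u}} (f : M ⟶ N) {i x j g} (h : IsLocalRep f.toFun i x j g)
    (v : TangentSpace (M.piece i).I x) :
    IsLocalRep (M := M.tangent) (N := N.tangent) (tangentFun f) i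
      (⟨x, v⟩ : TangentBundle (M.piece i).I (M.piece i)) j
      (tangentMap (M.piece i).I (N.piece j).I g) := by
  obtain ⟨U, hU, hUo, hxU⟩ := eventually_nhds_iff.1 (eventually_eventually_nhds.2 h)
  have hV : IsOpen ((Bundle.TotalSpace.proj : TangentBundle (M.piece i).I (M.piece i) → _) ⁻¹' U) :=
    hUo.preimage (M.piece i).contMDiff_proj.continuous
  have h1 : ContMDiffOn (M.piece i).I (N.piece j).I ∞ g U := fun y hy =>
    (hU y hy).self_of_nhds.1.contMDiffWithinAt
  have h2 := h1.contMDiffOn_tangentMapWithin (m := ∞) le_rfl hUo.uniqueMDiffOn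
  filter_upwards [hV.mem_nhds hxU] with w hw
  refine ⟨?_, ?_⟩
  · refine (h2.contMDiffAt (hV.mem_nhds hw)).congr_of_eventuallyEq ?_
    filter_upwards [hV.mem_nhds hw] with w' hw'
    exact (tangentMapWithin_eq_tangentMap (hUo.uniqueMDiffOn _ hw')
      ((hU _ hw').self_of_nhds.1.mdifferentiableAt (by simp))).symm
  · exact tangentFun_eq f (hU _ hw) w.2

/-- The tangent endofunctor. -/
def T : Man.{u} ⥤ Man.{u} where
  obj := tangent
  map f := ⟨tangentFun f, fun i w => by
    obtain ⟨j, g, h⟩ := f.smooth i (Bundle.TotalSpace.proj w)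
    exact ⟨j, _, h.tangent f w.2⟩⟩
  map_id M := by
    refine hom_ext ?_
    rintro ⟨i, x, v⟩
    refine (tangentFun_eq (𝟙 M) (.of_contMDiff contMDiff_id (fun _ => rfl) x) v).trans ?_
    exact congrArg (Sigma.mk i) (congrFun (tangentMap_id (I := (M.piece i).I)) _)
  map_comp {M N P} f f' := by
    refine hom_ext ?_
    rintro ⟨i, x, v⟩
    obtain ⟨j, g, h⟩ := f.smooth i x
    obtain ⟨k, g', h'⟩ := f'.smooth j (g x)
    refine (tangentFun_eq (f ≫ f') (h'.comp h) v).trans ?_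
    refine Eq.trans ?_ (congrArg (tangentFun f') (tangentFun_eq f h v)).symm
    refine Eq.trans ?_ (tangentFun_eq f' h' _).symm
    refine congrArg (Sigma.mk k) ?_
    exact tangentMap_comp_at _ (h'.smoothAt.mdifferentiableAt (by simp))
      (h.smoothAt.mdifferentiableAt (by simp))

/-- The canonical projections of the tangent bundles. -/
def proj : T ⟶ 𝟭 Man.{u} where
  app M := ⟨fun v => ⟨v.1, Bundle.TotalSpace.proj v.2⟩, fun i w =>
    ⟨i, _, .of_contMDiff (M := M.tangent) (M.piece i).contMDiff_proj (fun _ => rfl) w⟩⟩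
  naturality {M N} f := by
    refine hom_ext ?_
    rintro ⟨i, x, v⟩
    obtain ⟨j, g, h⟩ := f.smooth i x
    refine Eq.trans ?_ h.eq.symm
    exact congrArg (fun w : N.tangent => (⟨w.1, Bundle.TotalSpace.proj w.2⟩ : N))
      (tangentFun_eq f h v)

section Product
variable {X : Type u} [Fintype X]

/-- The product of a finite family of manifolds. -/
def pi (M : X → Man.{u}) : Man.{u} where
  ι := ∀ x, (M x).ι
  piece i := CornerMfd.pi fun x => (M x).piece (i x)

/-- The point of the product with given coordinates. -/
def pi.mk {M : X → Man.{u}} (p : ∀ x, M x) : pi M := ⟨fun x => (p x).1, fun x => (p x).2⟩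

/-- The projections of the product. -/
def pi.proj (M : X → Man.{u}) (x : X) : pi M ⟶ M x :=
  ⟨fun p => ⟨p.1 x, p.2 x⟩, fun i m =>
    ⟨i x, fun m => m x, .of_contMDiff (contMDiff_eval _ x) (fun _ => rfl) m⟩⟩

/-- The map into the product with given components. -/
def pi.lift {N : Man.{u}} {M : X → Man.{u}} (f : ∀ x, N ⟶ M x) : N ⟶ pi M :=
  ⟨fun p => pi.mk fun x => f x p, fun i n => by
    choose j g h using fun x => (f x).smooth i n
    refine ⟨j, fun n x => g x n, ?_⟩
    filter_upwards [eventually_all.2 h] with y hy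
    refine ⟨(contMDiffAt_pi_iff _ _).2 fun x => (hy x).1, ?_⟩
    simp only [fun x => (hy x).2]
    rfl⟩

/-- The product of a family of maps. -/
def pi.map {M N : X → Man.{u}} (f : ∀ x, M x ⟶ N x) : pi M ⟶ pi N :=
  pi.lift fun x => pi.proj M x ≫ f x

theorem pi.ext {M : X → Man.{u}} {p q : pi M} (h : ∀ x, pi.proj M x p = pi.proj M x q) : p = q :=
  congrArg (pi.mk (M := M)) (funext h)

/-- The canonical diffeomorphism from a product of tangent bundles to the tangent bundle of the
product: a family of vectors goes to the vector with these components. -/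
def pi.tangentMk (M : X → Man.{u}) : pi (fun x => T.obj (M x)) ⟶ T.obj (pi M) :=
  ⟨fun v => ⟨v.1, (⟨fun x => Bundle.TotalSpace.proj (v.2 x), fun x => (v.2 x).2⟩ :
      TangentBundle ((pi M).piece v.1).I ((pi M).piece v.1))⟩, fun i w =>
    ⟨i, _, .of_contMDiff (contMDiff_tangentPi fun x => ((M x).piece (i x)).I) (fun _ => rfl) w⟩⟩

theorem pi.tangentMk_proj (M : X → Man.{u}) (x : X) :
    pi.tangentMk M ≫ T.map (pi.proj M x) = pi.proj (fun x => T.obj (M x)) x := by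
  refine hom_ext ?_
  rintro ⟨i, w⟩
  refine (tangentFun_eq (pi.proj M x) (.of_contMDiff (contMDiff_eval _ x) (fun _ => rfl) _) _).trans ?_
  refine congrArg (Sigma.mk (i x)) ?_
  exact tangentMap_eval (fun x => ((M x).piece (i x)).I) x _

theorem pi.tangentMk_surj (M : X → Man.{u}) (v : T.obj (pi M)) : 
    ∃ w, pi.tangentMk M w = v :=
  ⟨⟨v.1, fun x => (⟨(Bundle.TotalSpace.proj v.2 : ∀ _, _) x, (v.2.2 : ∀ _, _) x⟩)⟩, rfl⟩
end Product
end Man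

namespace Man

/-- A surjective submersion: `f` is onto, and at every point `m` the differential maps the tangent
space at `m` onto the tangent space at `f m`. -/
def IsSurjSubmersion {M N : Man.{u}} (f : M ⟶ N) : Prop :=
  Function.Surjective f ∧ ∀ (m : M) (w : T.obj N), proj.app N w = f m →
    ∃ v : T.obj M, proj.app M v = m ∧ T.map f v = w

theorem congr_hom {M N : Man.{u}} {f g : M ⟶ N} (h : f = g) (p : M) : f p = g p := by rw [h]

theorem T_map_comp_apply {M N P : Man.{u}} (f : M ⟶ N) (g : N ⟶ P) (v : T.obj M) :
    T.map (f ≫ g) v = T.map g (T.map f v) :=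
  congr_hom (T.map_comp f g) v

theorem proj_map_apply {M N : Man.{u}} (f : M ⟶ N) (v : T.obj M) :
    proj.app N (T.map f v) = f (proj.app M v) :=
  congr_hom (proj.naturality f) v

theorem IsSurjSubmersion.comp {M N P : Man.{u}} {f : M ⟶ N} {g : N ⟶ P}
    (hf : IsSurjSubmersion f) (hg : IsSurjSubmersion g) : IsSurjSubmersion (f ≫ g) := by
  refine ⟨hg.1.comp hf.1, fun m w hw => ?_⟩
  obtain ⟨v, hv, rfl⟩ := hg.2 (f m) w hw
  obtain ⟨v', hv', rfl⟩ := hf.2 m v hv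
  exact ⟨v', hv', T_map_comp_apply f g v'⟩

theorem IsSurjSubmersion.of_iso {M N : Man.{u}} (e : M ≅ N) : IsSurjSubmersion e.hom := by
  refine ⟨fun q => ⟨e.inv q, congr_hom e.inv_hom_id q⟩, fun m w hw => ⟨T.map e.inv w, ?_, ?_⟩⟩
  · rw [proj_map_apply, hw]
    exact congr_hom e.hom_inv_id m
  · rw [← T_map_comp_apply, e.inv_hom_id, T.map_id, id_apply]

section Product
variable {X : Type u} [Fintype X]

theorem pi.tangent_ext {M : X → Man.{u}} {v w : T.obj (pi M)}
    (h : ∀ x, T.map (pi.proj M x) v = T.map (pi.proj M x) w) : v = w := by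
  obtain ⟨v', rfl⟩ := pi.tangentMk_surj M v
  obtain ⟨w', rfl⟩ := pi.tangentMk_surj M w
  refine congrArg _ (pi.ext fun x => ?_)
  rw [← pi.tangentMk_proj]
  exact h x

theorem pi.tangentMk_naturality {M N : X → Man.{u}} (f : ∀ x, M x ⟶ N x) :
    pi.map (fun x => T.map (f x)) ≫ pi.tangentMk N = pi.tangentMk M ≫ T.map (pi.map f) := by
  refine hom_ext fun v => pi.tangent_ext fun x => ?_
  have h1 := congr_hom (pi.tangentMk_proj N x) (pi.map (fun x => T.map (f x)) v)
  have h2 := congr_hom (pi.tangentMk_proj M x) v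
  simp only [comp_apply] at h1 h2 ⊢
  rw [h1, ← T_map_comp_apply]
  change _ = T.map (pi.proj M x ≫ f x) _
  rw [T_map_comp_apply, h2]
  rfl

theorem IsSurjSubmersion.pi_map {M N : X → Man.{u}} {f : ∀ x, M x ⟶ N x}
    (hf : ∀ x, IsSurjSubmersion (f x)) : IsSurjSubmersion (pi.map f) := by
  constructor
  · intro q
    choose m hm using fun x => (hf x).1 (pi.proj N x q)
    exact ⟨pi.mk m, pi.ext hm⟩
  · intro m w hw
    obtain ⟨w, rfl⟩ := pi.tangentMk_surj N w
    choose v hv hv' using fun x => (hf x).2 (pi.proj M x m) (pi.proj _ x w)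
      (congrArg (pi.proj N x) hw)
    refine ⟨pi.tangentMk M (pi.mk v), pi.ext hv, ?_⟩
    rw [← comp_apply, ← pi.tangentMk_naturality, comp_apply]
    exact congrArg _ (pi.ext hv')

end Product

end Man

/-- A hybrid phase space: a small category of nodes and edges, a manifold for every node, a
relation for every edge; identities go to diagonals and composites to composites. The last field
says that the disjoint union of the manifolds has countably many pieces. -/
structure HyPh : Type (u + 1) where
  Node : Type u
  [category : SmallCategory Node]
  obj : Node → Man.{u}
  rel : ∀ {s t : Node}, (s ⟶ t) → SetRel (obj s) (obj t)
  rel_id : ∀ s, rel (𝟙 s) = SetRel.id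
  rel_comp : ∀ {s t r : Node} (γ : s ⟶ t) (γ' : t ⟶ r), rel (γ ≫ γ') = (rel γ).comp (rel γ')
  countable : Countable (Σ s, (obj s).ι)

namespace HyPh
attribute [instance] category countable

/-- A morphism of hybrid phase spaces: a functor of the source categories and a smooth map for
every node, such that related points go to related points along every edge. -/
@[ext]
structure Hom (a b : HyPh.{u}) : Type u where
  functor : a.Node ⥤ b.Node
  app : ∀ s, a.obj s ⟶ b.obj (functor.obj s)
  map_rel : ∀ {s t : a.Node} (γ : s ⟶ t) (p : a.obj s) (q : a.obj t),
    (p, q) ∈ a.rel γ → (app s p, app t q) ∈ b.rel (functor.map γ)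

/-- The category of hybrid phase spaces. -/
instance : Category HyPh.{u} where
  Hom := Hom
  id a := ⟨𝟭 _, fun s => 𝟙 (a.obj s), fun _ _ _ h => h⟩
  comp f g := ⟨f.functor ⋙ g.functor, fun s => f.app s ≫ g.app (f.functor.obj s),
    fun γ p q h => g.map_rel _ _ _ (f.map_rel γ p q h)⟩

/-- The underlying manifold of a hybrid phase space: the disjoint union of the manifolds of its
nodes. -/
def U : HyPh.{u} ⥤ Man.{u} where
  obj a :=
    { ι := Σ s, (a.obj s).ι
      piece i := (a.obj i.1).piece i.2 }
  map {a b} f := ⟨fun p => ⟨⟨f.functor.obj p.1.1, (f.app p.1.1 ⟨p.1.2, p.2⟩).1⟩,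
      (f.app p.1.1 ⟨p.1.2, p.2⟩).2⟩, fun i m => by
    obtain ⟨j, g, h⟩ := (f.app i.1).smooth i.2 m
    refine ⟨⟨f.functor.obj i.1, j⟩, g, ?_⟩
    filter_upwards [h] with y hy
    refine ⟨hy.1, ?_⟩
    exact congrArg (fun q : b.obj _ => (⟨⟨f.functor.obj i.1, q.1⟩, q.2⟩ :
      Σ k : Σ s, (b.obj s).ι, (b.obj k.1).piece k.2)) hy.2⟩
  map_id _ := rfl
  map_comp _ _ := rfl

section Product
variable {X : Type u} [Fintype X]

/-- The product of a finite family of hybrid phase spaces: the product of the source categories,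
with products of manifolds and componentwise relations. -/
def pi (a : X → HyPh.{u}) : HyPh.{u} where
  Node := ∀ x, (a x).Node
  obj s := Man.pi fun x => (a x).obj (s x)
  rel {s t} γ := {pq | ∀ x, (Man.pi.proj (fun x => (a x).obj (s x)) x pq.1,
    Man.pi.proj (fun x => (a x).obj (t x)) x pq.2) ∈ (a x).rel ((γ : ∀ x, s x ⟶ t x) x)}
  rel_id s := by
    ext ⟨p, q⟩
    have h (x : X) := (a x).rel_id (s x)
    constructor
    · intro h'
      exact Man.pi.ext fun x => ((h x).le (h' x) :)
    · rintro rfl x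
      exact (h x).ge rfl
  rel_comp γ γ' := by
    ext ⟨p, q⟩
    constructor
    · intro h
      choose r hr using fun x => ((a x).rel_comp _ _).le (h x)
      exact ⟨Man.pi.mk r, fun x => (hr x).1, fun x => (hr x).2⟩
    · rintro ⟨r, h, h'⟩ x
      exact ((a x).rel_comp _ _).ge ⟨_, h x, h' x⟩
  countable := Function.Injective.countable
    (f := fun i : Σ s : ∀ x, (a x).Node, ∀ x, ((a x).obj (s x)).ι =>
      (fun x => ⟨i.1 x, i.2 x⟩ : ∀ x, Σ s, ((a x).obj s).ι))
    fun i j h => congrArg (fun k : ∀ x, Σ s, ((a x).obj s).ι =>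
      (⟨fun x => (k x).1, fun x => (k x).2⟩ :
        Σ s : ∀ x, (a x).Node, ∀ x, ((a x).obj (s x)).ι)) h

/-- The projections of the product. -/
def pi.proj (a : X → HyPh.{u}) (x : X) : pi a ⟶ a x :=
  ⟨Pi.eval _ x, fun s => Man.pi.proj (fun x => (a x).obj (s x)) x, fun _ _ _ h => h x⟩

/-- The morphism into the product with given components. -/
def pi.lift {c : HyPh.{u}} {a : X → HyPh.{u}} (f : ∀ x, c ⟶ a x) : c ⟶ pi a :=
  ⟨Functor.pi' fun x => (f x).functor, fun s => Man.pi.lift fun x => (f x).app s,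
    fun γ p q h x => (f x).map_rel γ p q h⟩

theorem pi.lift_proj {c : HyPh.{u}} {a : X → HyPh.{u}} (f : ∀ x, c ⟶ a x) (x : X) :
    pi.lift f ≫ pi.proj a x = f x := rfl

theorem pi.hom_ext {c : HyPh.{u}} {a : X → HyPh.{u}} {f g : c ⟶ pi a}
    (h : ∀ x, f ≫ pi.proj a x = g ≫ pi.proj a x) : f = g :=
  congrArg (pi.lift (a := a)) (funext h)

/-- The canonical isomorphism from the underlying manifold of a product to the product of the
underlying manifolds. -/
def UPi (a : X → HyPh.{u}) : U.obj (pi a) ≅ Man.pi fun x => U.obj (a x) where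
  hom := Man.pi.lift fun x => U.map (pi.proj a x)
  inv := ⟨fun p => ⟨⟨fun x => (p.1 x).1, fun x => (p.1 x).2⟩, p.2⟩, fun i _ =>
    ⟨⟨fun x => (i x).1, fun x => (i x).2⟩, fun p => p,
      Filter.Eventually.of_forall fun _ => ⟨contMDiffAt_id, rfl⟩⟩⟩
  hom_inv_id := rfl
  inv_hom_id := rfl

end Product

end HyPh

open HyPh (U)

/-- The category of hybrid surjective submersions: the full subcategory of the arrow category of
hybrid phase spaces on those `p` for which `U p` is a surjective submersion. -/
abbrev HySSub : Type (u + 1) :=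
  ObjectProperty.FullSubcategory (C := Arrow HyPh.{u}) fun a => Man.IsSurjSubmersion (U.map a.hom)

namespace HySSub

/-- The total space. -/
abbrev tot (a : HySSub.{u}) : HyPh.{u} := a.obj.left

/-- The state space. -/
abbrev st (a : HySSub.{u}) : HyPh.{u} := a.obj.right

/-- The submersion itself. -/
abbrev p (a : HySSub.{u}) : a.tot ⟶ a.st := a.obj.hom

/-- The component of a morphism on total spaces. -/
abbrev totMap {a b : HySSub.{u}} (f : a ⟶ b) : a.tot ⟶ b.tot := f.hom.left

/-- The component of a morphism on state spaces. -/
abbrev stMap {a b : HySSub.{u}} (f : a ⟶ b) : a.st ⟶ b.st := f.hom.right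

/-- An interconnection is a morphism which is an isomorphism on state spaces. -/
class IsInterconnection {a b : HySSub.{u}} (f : a ⟶ b) : Prop where
  isIso_stMap : IsIso (stMap f)

attribute [instance] IsInterconnection.isIso_stMap

theorem comm {a b : HySSub.{u}} (f : a ⟶ b) : totMap f ≫ b.p = a.p ≫ stMap f := f.hom.w

section Product
variable {X : Type u} [Fintype X]

/-- The product of a finite family of hybrid surjective submersions. -/
def pi (a : X → HySSub.{u}) : HySSub.{u} where
  obj := Arrow.mk (HyPh.pi.lift fun x => HyPh.pi.proj (fun x => (a x).tot) x ≫ (a x).p)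
  property := by
    have h : U.map (HyPh.pi.lift fun x => HyPh.pi.proj (fun x => (a x).tot) x ≫ (a x).p) =
        (HyPh.UPi fun x => (a x).tot).hom ≫ Man.pi.map (fun x => U.map (a x).p) ≫
          (HyPh.UPi fun x => (a x).st).symm.hom := rfl
    refine (congrArg Man.IsSurjSubmersion h).mpr ?_
    exact (Man.IsSurjSubmersion.of_iso _).comp
      ((Man.IsSurjSubmersion.pi_map fun x => (a x).property).comp (Man.IsSurjSubmersion.of_iso _))

/-- The projections of the product. -/
def pi.proj (a : X → HySSub.{u}) (x : X) : pi a ⟶ a x :=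
  ObjectProperty.homMk (Arrow.homMk (HyPh.pi.proj _ x) (HyPh.pi.proj _ x) rfl)

/-- The morphism into the product with given components. -/
def pi.lift {c : HySSub.{u}} {a : X → HySSub.{u}} (f : ∀ x, c ⟶ a x) : c ⟶ pi a :=
  ObjectProperty.homMk (Arrow.homMk (HyPh.pi.lift fun x => totMap (f x))
    (HyPh.pi.lift fun x => stMap (f x)) (HyPh.pi.hom_ext fun x => comm (f x)))

/-- The morphism `∏ b ⟶ ∏ a` induced by a map `φ` of index sets and morphisms
`b (φ x) ⟶ a x`. -/
def piMap {X Y : Type u} [Fintype X] [Fintype Y] {a : X → HySSub.{u}} {b : Y → HySSub.{u}}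
    (φ : X → Y) (Φ : ∀ x, b (φ x) ⟶ a x) : pi b ⟶ pi a :=
  pi.lift fun x => pi.proj b (φ x) ≫ Φ x

end Product

/-- The controls on a hybrid surjective submersion: smooth maps `U a_tot ⟶ T U a_st` over the
submersion. -/
@[ext]
structure Crl (a : HySSub.{u}) : Type u where
  hom : U.obj a.tot ⟶ Man.T.obj (U.obj a.st)
  comp_proj : hom ≫ Man.proj.app (U.obj a.st) = U.map a.p

/-- The relation on controls given by a morphism `f`: `V` and `W` are `f`-related if
`T (U f_st) ∘ V = W ∘ U f_tot`. -/
def CrlRel {a b : HySSub.{u}} (f : a ⟶ b) : SetRel (Crl a) (Crl b) :=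
  {VW | VW.1.hom ≫ Man.T.map (U.map (stMap f)) = U.map (totMap f) ≫ VW.2.hom}

/-- The map on controls given by an interconnection `f`, taking `V` to
`T (U f_st⁻¹) ∘ V ∘ U f_tot`. -/
def CrlMap {a b : HySSub.{u}} (f : a ⟶ b) [IsInterconnection f] (V : Crl b) : Crl a :=
  ⟨U.map (totMap f) ≫ V.hom ≫ Man.T.map (U.map (inv (stMap f))), by
    have h := Man.proj.naturality (U.map (inv (stMap f)))
    dsimp only [Functor.id_obj, Functor.id_map] at h
    rw [Category.assoc, Category.assoc, h, ← Category.assoc V.hom, V.comp_proj, ← U.map_comp, ← U.map_comp,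
      ← Category.assoc, comm, Category.assoc, IsIso.hom_inv_id, Category.comp_id]⟩

/-- The product of a family of controls, a control on the product: `∏ v_x` composed with the
canonical isomorphisms `U (∏ a_tot) ≅ ∏ U a_tot` and `∏ T (U a_st) ≅ T (∏ U a_st) ≅ T (U (∏ a_st))`. -/
def CrlPi {X : Type u} [Fintype X] (a : X → HySSub.{u}) (v : ∀ x, Crl (a x)) : Crl (pi a) :=
  ⟨(HyPh.UPi fun x => (a x).tot).hom ≫ Man.pi.map (fun x => (v x).hom) ≫
      Man.pi.tangentMk (fun x => U.obj (a x).st) ≫ Man.T.map (HyPh.UPi fun x => (a x).st).inv, by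
    refine Man.hom_ext fun q => (Man.proj_map_apply _ _).trans ?_
    have h : Man.pi.map (fun x => (v x).hom) ≫ Man.pi.tangentMk (fun x => U.obj (a x).st) ≫
        Man.proj.app _ = Man.pi.map (fun x => U.map (a x).p) := by
      rw [← funext fun x => (v x).comp_proj]
      rfl
    exact congrArg (HyPh.UPi fun x => (a x).st).inv
      (Man.congr_hom h ((HyPh.UPi fun x => (a x).tot).hom q))⟩

/-- The relation between families of controls which are related componentwise. -/
def CrlPiRel {X Y : Type u} {a : X → HySSub.{u}} {b : Y → HySSub.{u}}
    (φ : X → Y) (Φ : ∀ x, b (φ x) ⟶ a x) : SetRel (∀ y, Crl (b y)) (∀ x, Crl (a x)) :=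
  {wv | ∀ x, (wv.1 (φ x), wv.2 x) ∈ CrlRel (Φ x)}

end HySSub

/-- A network of hybrid open systems: a finite family of hybrid surjective submersions and an
interconnection `i` into their product. -/
structure Network (X : Type u) [Fintype X] where
  sys : X → HySSub.{u}
  a : HySSub.{u}
  i : a ⟶ HySSub.pi sys
  [interconnection : HySSub.IsInterconnection i]

attribute [instance] Network.interconnection

/-- A morphism of networks: a map `φ` of index sets, morphisms `Φ x` of subsystems, and a morphism
`z` of the interconnected systems which is compatible with the interconnections. -/
structure Network.Hom {X Y : Type u} [Fintype X] [Fintype Y] (N : Network X) (N' : Network Y) where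
  φ : X → Y
  Φ : ∀ x, N'.sys (φ x) ⟶ N.sys x
  z : N'.a ⟶ N.a
  comm : z ≫ N.i = N'.i ≫ HySSub.piMap φ Φ

/-- The map assigning to controls on the subsystems the control on the interconnected system. -/
def Network.control {X : Type u} [Fintype X] (N : Network X) (v : ∀ x, HySSub.Crl (N.sys x)) :
    HySSub.Crl N.a :=
  HySSub.CrlMap N.i (HySSub.CrlPi N.sys v)

/-- There is a 1-morphism from the relation `R` to the relation `R'` over the functions `f` and `g`,
in the double category of sets, functions, relations and inclusions. -/
def IsOneMorphism {A B A' B' : Type u} (R : SetRel A B) (f : A → A') (g : B → B')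
    (R' : SetRel A' B') : Prop :=
  Prod.map f g '' R ⊆ R'

end

end Hybrid

namespace Hybrid

open HyPh (U)

/-! A control `V` is an arrow from `U a_tot` to `T U a_st`. Being `f`-related to `W` means that `V`,
`W`, `U f_tot` and `T U f_st` form a commutative square. The theorem is a pasting of such squares,
and relatedness is stable under pasting (`CrlRel.comp`). Two universal properties supply the
squares.

Pullback along an interconnection `g`: since `T U g_st` is invertible, a square over `f ≫ g` ending
at `W` is the same thing as a square over `f` ending at `g^* W`. Hence `g^* W` is `g`-related to `W`
(`crlMap_rel`), and a relation along `f ≫ g` descends to one along `f` (`CrlRel.crlMap`).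

Products: `T U` carries finite products of hybrid phase spaces to products, so an equation between
maps into `T U (∏ a)` may be tested on projections. Hence `𝒫(v)` is related to each `v x` along the
projection (`crlPi_rel_proj`), and a control related to every `v x` along `f x` is related to `𝒫(v)`
along the map with components `f x` (`CrlRel.pi_lift`).

For a morphism of networks, the descent property for `i_a` reduces relatedness along `z` to
relatedness along `z ≫ i_a`, which equals `i_b ≫ Π(φ, Φ)`. Along the latter, `i_b^* 𝒫(w)` is related
to `𝒫(w)` by the pullback property, and `𝒫(w)` to `𝒫(v)` by the product property. -/

/-- Morphisms into `T U (∏ a)` are determined by their components in the `T U (a x)`. -/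
theorem HyPh.tangent_pi_hom_ext {X : Type u} [Fintype X] {M : Man.{u}} {a : X → HyPh.{u}}
    {f g : M ⟶ Man.T.obj (U.obj (HyPh.pi a))}
    (h : ∀ x, f ≫ Man.T.map (U.map (HyPh.pi.proj a x)) =
      g ≫ Man.T.map (U.map (HyPh.pi.proj a x))) : f = g := by
  -- Tangent vectors are separated by projections on `T (∏ U a)`, so both maps are first moved there
  -- along `T` of the isomorphism `UPi`. By definition `UPi` followed by a projection of manifolds
  -- is `U` of the hybrid projection, which is why `h x` applies.
  have hiso : f ≫ Man.T.map (HyPh.UPi a).hom = g ≫ Man.T.map (HyPh.UPi a).hom := by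
    refine Man.hom_ext fun p => Man.pi.tangent_ext fun x => ?_
    rw [Man.comp_apply, Man.comp_apply, ← Man.T_map_comp_apply, ← Man.T_map_comp_apply]
    exact Man.congr_hom (h x) p
  -- `T` of an isomorphism is an isomorphism, in particular a monomorphism.
  exact (cancel_mono _).1 hiso

/-! ### Relatedness of controls: pasting, interconnections and products -/

namespace HySSub

/-- The squares for `f` and `g` share the side `W`. Functoriality of `U` and `T` identifies the
outer edges of the pasted rectangle with those of the square for `f ≫ g`. -/
theorem CrlRel.comp {a b c : HySSub.{u}} {f : a ⟶ b} {g : b ⟶ c} {V : Crl a} {W : Crl b}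
    {Z : Crl c} (h : (V, W) ∈ CrlRel f) (h' : (W, Z) ∈ CrlRel g) : (V, Z) ∈ CrlRel (f ≫ g) := by
  change V.hom ≫ Man.T.map (U.map (stMap f ≫ stMap g)) =
    U.map (totMap f ≫ totMap g) ≫ Z.hom
  have h₁ : V.hom ≫ Man.T.map (U.map (stMap f)) = U.map (totMap f) ≫ W.hom := h
  have h₂ : W.hom ≫ Man.T.map (U.map (stMap g)) = U.map (totMap g) ≫ Z.hom := h'
  rw [U.map_comp, U.map_comp, Man.T.map_comp, reassoc_of% h₁, h₂, Category.assoc]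

/-- The control obtained along an interconnection is related to the original one. -/
theorem crlMap_rel {a b : HySSub.{u}} (f : a ⟶ b) [IsInterconnection f] (V : Crl b) :
    (CrlMap f V, V) ∈ CrlRel f := by
  change (U.map (totMap f) ≫ V.hom ≫ Man.T.map (U.map (inv (stMap f)))) ≫
    Man.T.map (U.map (stMap f)) = _
  -- The pulled-back control ends with `T U` of the inverse of `f_st`, which cancels against `T U
  -- f_st`.
  rw [Category.assoc, Category.assoc, ← Man.T.map_comp, ← U.map_comp, IsIso.inv_hom_id,
    U.map_id, Man.T.map_id, Category.comp_id]

/-- A control related to `W` along `f ≫ g`, with `g` an interconnection, is related along `f` to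
the control obtained from `W` along `g`. -/
theorem CrlRel.crlMap {a b c : HySSub.{u}} {f : a ⟶ b} {g : b ⟶ c} [IsInterconnection g]
    {V : Crl a} {W : Crl c} (h : (V, W) ∈ CrlRel (f ≫ g)) : (V, CrlMap g W) ∈ CrlRel f := by
  change V.hom ≫ Man.T.map (U.map (stMap f)) =
    U.map (totMap f) ≫ U.map (totMap g) ≫ W.hom ≫ Man.T.map (U.map (inv (stMap g)))
  have h' : V.hom ≫ Man.T.map (U.map (stMap f ≫ stMap g)) =
    U.map (totMap f ≫ totMap g) ≫ W.hom := h
  rw [U.map_comp (totMap f), Category.assoc] at h'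
  -- Read from right to left, `h'` replaces `U f_tot`, `U g_tot` and `W` by `V` followed by `T U
  -- (f_st ≫ g_st)`. The factor `g_st` then meets its inverse.
  rw [← reassoc_of% h', ← Man.T.map_comp, ← U.map_comp, Category.assoc, IsIso.hom_inv_id,
    Category.comp_id]

section Product
variable {X : Type u} [Fintype X]

/-- A product of controls is related to its factors along the projections. -/
theorem crlPi_rel_proj (a : X → HySSub.{u}) (v : ∀ x, Crl (a x)) (x : X) :
    (CrlPi a v, v x) ∈ CrlRel (pi.proj a x) := by
  refine Man.hom_ext fun p => ?_
  -- The family of vectors `v x` evaluated at the components of `p`, before `tangentMk` assembles it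
  -- into one tangent vector of the product.
  let q := Man.pi.map (fun x => (v x).hom) ((HyPh.UPi fun x => (a x).tot).hom p)
  change Man.T.map (U.map (HyPh.pi.proj (fun x => (a x).st) x))
    (Man.T.map (HyPh.UPi fun x => (a x).st).inv
      (Man.pi.tangentMk (fun x => U.obj (a x).st) q)) = _
  -- The inverse of `UPi` followed by `U` of the hybrid projection unfolds to the projection of
  -- manifolds, so what remains is that `tangentMk` is compatible with projections.
  rw [← Man.T_map_comp_apply]
  exact Man.congr_hom (Man.pi.tangentMk_proj (fun x => U.obj (a x).st) x) q

/-- A control related to all factors of a product of controls is related to the product. -/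
theorem CrlRel.pi_lift {c : HySSub.{u}} {a : X → HySSub.{u}} {f : ∀ x, c ⟶ a x} {V : Crl c}
    {v : ∀ x, Crl (a x)} (h : ∀ x, (V, v x) ∈ CrlRel (f x)) :
    (V, CrlPi a v) ∈ CrlRel (pi.lift f) := by
  -- After composition with `T U` of the projection to `x`, the square for the lift becomes the
  -- square `hx` for `f x`: `hp` replaces the product control by `v x`, and the lift followed by the
  -- projection is `f x` by definition, on state and on total spaces.
  refine HyPh.tangent_pi_hom_ext fun x => ?_
  have hx : V.hom ≫ Man.T.map (U.map (stMap (f x))) = U.map (totMap (f x)) ≫ (v x).hom := h x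
  have hp : (CrlPi a v).hom ≫ Man.T.map (U.map (HyPh.pi.proj (fun x => (a x).st) x)) =
    U.map (HyPh.pi.proj (fun x => (a x).tot) x) ≫ (v x).hom := crlPi_rel_proj a v x
  refine (Category.assoc _ _ _).trans (Eq.trans ?_ (Category.assoc _ _ _).symm)
  refine Eq.trans ?_ (congrArg (U.map (totMap (pi.lift f)) ≫ ·) hp).symm
  refine Eq.trans ?_ (hx.trans ?_)
  · exact congrArg (V.hom ≫ ·) (Man.T.map_comp _ _).symm
  · rfl

/-- Products of componentwise related controls are related along the induced morphism. -/
theorem crlPi_rel_piMap {Y : Type u} [Fintype Y] {a : X → HySSub.{u}} {b : Y → HySSub.{u}}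
    {φ : X → Y} {Φ : ∀ x, b (φ x) ⟶ a x} {w : ∀ y, Crl (b y)} {v : ∀ x, Crl (a x)}
    (h : (w, v) ∈ CrlPiRel φ Φ) : (CrlPi b w, CrlPi a v) ∈ CrlRel (piMap φ Φ) :=
  -- The component at `x` of `piMap φ Φ` is the projection to `φ x` followed by `Φ x`, so the
  -- intermediate control is `w (φ x)`. Nothing is asked of `φ`: a factor may be used several times
  -- or not at all.
  CrlRel.pi_lift fun x => CrlRel.comp (crlPi_rel_proj b w (φ x)) (h x)

end Product

end HySSub

/-! ### Morphisms of networks -/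

theorem Network.Hom.control_rel {X Y : Type u} [Fintype X] [Fintype Y] {N : Network.{u} X}
    {N' : Network.{u} Y} (F : N.Hom N') {w : ∀ y, HySSub.Crl (N'.sys y)}
    {v : ∀ x, HySSub.Crl (N.sys x)} (h : (w, v) ∈ HySSub.CrlPiRel F.φ F.Φ) :
    (N'.control w, N.control v) ∈ HySSub.CrlRel F.z := by
  -- `N.control v` is a pullback along the interconnection `N.i`, so it suffices to relate
  -- `N'.control w` to the product control along `F.z ≫ N.i`.
  refine HySSub.CrlRel.crlMap ?_
  rw [F.comm]
  -- The intermediate control is the product of the `w y`, on the product of the subsystems of `N'`.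
  exact HySSub.CrlRel.comp (HySSub.crlMap_rel _ _) (HySSub.crlPi_rel_piMap h)

end Hybrid

theorem mainTheorem3 {X Y : Type u} [Fintype X] [Fintype Y]
    (N : Hybrid.Network.{u} X) (N' : Hybrid.Network.{u} Y) (F : N.Hom N') :
    Hybrid.IsOneMorphism (Hybrid.HySSub.CrlPiRel F.φ F.Φ) N'.control N.control
      (Hybrid.HySSub.CrlRel F.z) ∧
    ∀ (w : ∀ y, Hybrid.HySSub.Crl (N'.sys y)) (v : ∀ x, Hybrid.HySSub.Crl (N.sys x)),
      (∀ x, (w (F.φ x), v x) ∈ Hybrid.HySSub.CrlRel (F.Φ x)) →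
      (N'.control w, N.control v) ∈ Hybrid.HySSub.CrlRel F.z := by
  refine ⟨?_, fun w v h => F.control_rel h⟩
  -- An element of the image is a pair `(N'.control w, N.control v)` with `w` and `v` componentwise
  -- related, so the inclusion is the pointwise statement again.
  rintro _ ⟨⟨w, v⟩, h, rfl⟩
  exact F.control_rel h
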